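/- For $\mathbf n=(n_1,\dots,n_d)$ let $\mathbb C^{\mathbf n}=\bigotimes_{j=1}^d\mathbb C^{n_j}$ carry its standard inner product $\langle\cdot,\cdot\rangle$ and Hilbert–Schmidt norm $\|\cdot\|$. A state is a tensor $T$ with $\|T\|=1$, and $\Pi^{\mathbf n}=\{x_1\otimes\cdots\otimes x_d:\ x_j\in\mathbb C^{n_j},\ \|x_j\|=1\}$ is the set of product states. The spectral and nuclear norms over $\mathbb C$ are $$\|T\|_\infty=\max_{X\in\Pi^{\mathbf n}}|\langle T,X\rangle|,\qquad \|T\|_1=\min\Big\{\sum_{i=1}^r\prod_{j=1}^d\|x_{i,j}\|:\ T=\sum_{i=1}^r x_{i,1}\otimes\cdots\otimes x_{i,d}\Big\},$$ and $$\alpha(\mathbf n,\mathbb C)=\max\{\|T\|_1:\ T\in\mathbb C^{\mathbf n},\ \|T\|=1\},\qquad \beta(\mathbf n,\mathbb C)=\min\{\|T\|_\infty:\ T\in\mathbb C^{\mathbf n},\ \|T\|=1\}.$$ Write $2^{\times4}=(2,2,2,2)$, let $|0\rangle,|1\rangle$ be the standard basis of $\mathbb C^2$, and let $M_4$ be the Higuchi–Sudbery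 $4$-qubit state $$M_4=\frac1{\sqrt6}\Big(|0011\rangle+|1100\rangle+\omega\big(|1010\rangle+|0101\rangle\big)+\omega^2\big(|1001\rangle+|0110\rangle\big)\Big),\qquad \omega=e^{2\pi i/3}.$$ Then $\|M_4\|_\infty=\frac{\sqrt2}{3}$. Hence $$\beta(2^{\times4},\mathbb C)=\frac{\sqrt2}{3},\qquad \alpha(2^{\times4},\mathbb C)=\frac{3}{\sqrt2},$$ and $M_4$ is a most entangled $4$-qubit state: $\|M_4\|=1$, and among all $4$-qubit states $M_4$ maximizes the geometric measure of entanglement $\mathrm{dist}(T,\Pi^{2^{\times4}})=\min\{\|T-Y\|:\ Y\in\Pi^{2^{\times4}}\}$, the quantity $\eta(T)=-\log_2\|T\|_\infty^2$, and the quantity $\log_2\|T\|_1^2$. -/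

import Mathlib

noncomputable section

namespace Tensors

/-- `𝕜^{n₁} ⊗ ⋯ ⊗ 𝕜^{n_d}`: arrays of entries `t_{i₁,…,i_d}` with the Hilbert–Schmidt inner product
and norm. -/
abbrev Tensor (𝕜 : Type*) {d : ℕ} (n : Fin d → ℕ) : Type _ :=
  EuclideanSpace 𝕜 ((j : Fin d) → Fin (n j))

variable {𝕜 : Type*} [RCLike 𝕜] {d : ℕ} {n : Fin d → ℕ}

/-- The rank-one tensor `x₁ ⊗ ⋯ ⊗ x_d`. -/
def tprod (x : (j : Fin d) → EuclideanSpace 𝕜 (Fin (n j))) : Tensor 𝕜 n :=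
  WithLp.toLp 2 fun i => ∏ j, x j (i j)

/-- The set `Π^n(𝕜)` of tensor products of unit vectors (product states). -/
def productStates (𝕜 : Type*) [RCLike 𝕜] {d : ℕ} (n : Fin d → ℕ) : Set (Tensor 𝕜 n) :=
  {X | ∃ x : (j : Fin d) → EuclideanSpace 𝕜 (Fin (n j)), (∀ j, ‖x j‖ = 1) ∧ X = tprod x}

/-- The numbers `|⟨T, X⟩|`, `X` a product state. -/
def overlaps (T : Tensor 𝕜 n) : Set ℝ :=
  (fun X => ‖inner 𝕜 X T‖) '' productStates 𝕜 n

/-- The spectral norm `‖T‖_∞`. -/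
def spectralNorm (T : Tensor 𝕜 n) : ℝ := sSup (overlaps T)

/-- The nuclear norm `‖T‖_1`: the least `∑ᵢ ∏ⱼ ‖x_{i,j}‖` over the decompositions
`T = ∑ᵢ x_{i,1} ⊗ ⋯ ⊗ x_{i,d}`. -/
def nuclearNorm (T : Tensor 𝕜 n) : ℝ :=
  sInf {s | ∃ (r : ℕ) (x : Fin r → (j : Fin d) → EuclideanSpace 𝕜 (Fin (n j))),
    T = ∑ i, tprod (x i) ∧ s = ∑ i, ∏ j, ‖x i j‖}

/-- The spectral norms of the tensors of Hilbert–Schmidt norm one. -/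
def spectralValues (𝕜 : Type*) [RCLike 𝕜] {d : ℕ} (n : Fin d → ℕ) : Set ℝ :=
  spectralNorm '' {T : Tensor 𝕜 n | ‖T‖ = 1}

/-- The nuclear norms of the tensors of Hilbert–Schmidt norm one. -/
def nuclearValues (𝕜 : Type*) [RCLike 𝕜] {d : ℕ} (n : Fin d → ℕ) : Set ℝ :=
  nuclearNorm '' {T : Tensor 𝕜 n | ‖T‖ = 1}

/-- `α(n, 𝕜)`, the maximal nuclear norm of a unit tensor. -/
def alpha (𝕜 : Type*) [RCLike 𝕜] {d : ℕ} (n : Fin d → ℕ) : ℝ := sSup (nuclearValues 𝕜 n)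

/-- `β(n, 𝕜)`, the minimal spectral norm of a unit tensor. -/
def beta (𝕜 : Type*) [RCLike 𝕜] {d : ℕ} (n : Fin d → ℕ) : ℝ := sInf (spectralValues 𝕜 n)

/-- The geometric measure of entanglement: the distance to the set of product states. -/
def geometricMeasure (T : Tensor ℂ n) : ℝ := Metric.infDist T (productStates ℂ n)

/-- `η(T) = -log₂ ‖T‖_∞²`. -/
def eta (T : Tensor ℂ n) : ℝ := -Real.logb 2 (spectralNorm T ^ 2)

/-- `ω(T) = log₂ ‖T‖_1²`. -/
def omega (T : Tensor ℂ n) : ℝ := Real.logb 2 (nuclearNorm T ^ 2)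

/-- `T` is a state that is most entangled with respect to the measure `E`. -/
def IsMostEntangled (E : Tensor ℂ n → ℝ) (T : Tensor ℂ n) : Prop :=
  ‖T‖ = 1 ∧ ∀ S : Tensor ℂ n, ‖S‖ = 1 → E S ≤ E T

/-- The format `2^{×d} = (2, …, 2)` of `d` qubits. -/
abbrev qubits (d : ℕ) : Fin d → ℕ := fun _ => 2

/-- The basis state `|i₁ i₂ ⋯ i_d⟩`, that is `e_{i₁} ⊗ ⋯ ⊗ e_{i_d}`. -/
def ket (i : Fin d → Fin 2) : Tensor ℂ (qubits d) :=
  tprod fun j => EuclideanSpace.single (i j) (1 : ℂ)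

/-- The Higuchi–Sudbery state `M₄`. -/
def M4 : Tensor ℂ (qubits 4) :=
  let ω : ℂ := Complex.exp (2 * Real.pi * Complex.I / 3)
  ((1 / Real.sqrt 6 : ℝ) : ℂ) •
    (ket ![0, 0, 1, 1] + ket ![1, 1, 0, 0]
      + ω • (ket ![1, 0, 1, 0] + ket ![0, 1, 0, 1])
      + ω ^ 2 • (ket ![1, 0, 0, 1] + ket ![0, 1, 1, 0]))

end Tensors

end

namespace Tensors

/-! Everything rests on two bounds: each unit 4-qubit tensor has squared overlap at least 2/9 with
some product state, and `M4` never exceeds 2/9.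

Lower bound: one of the two slices along the first qubit carries at least half of the squared norm,
so it suffices that a unit 3-qubit tensor has squared overlap at least 4/9. Let `A`, `B` be the 2 ×
2 slices of such a tensor. Now `det (z₀A + z₁B)` is a quadratic form in `z`, and a unitary change of
`z` removes its mixed term (`exists_takagi`). Phases then make the two determinant terms cancel
partially, a choice of sign makes the Hilbert–Schmidt norm at least its average, and `exists_weight`
supplies moduli for which the characteristic polynomial of `CᴴC`, `C = z₀A + z₁B`, is nonpositive at
4/9. Hence the largest squared singular value of `C` is at least 4/9.

Upper bound: contracting `√6 M₄` with the last two qubits gives a 2 × 2 matrix with squared norm `1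
+ t` and determinant of modulus `t`. Its squared stretching factors `m` satisfy `t² ≤ m (1 + t -
m)`, which forces `m ≤ 4/3` (`m4_form_le`), and 4/3 divided by 6 is 2/9.

Duality transfers this to the nuclear norm: Hahn–Banach puts `(√2/3) T` in the closed convex hull of
the product states, while `‖T‖² ≤ ‖T‖_1 ‖T‖_∞` gives the converse for `M4`. Distances follow from
`‖T - Y‖² = 2 - 2 Re⟨T, Y⟩`. -/

/-! ### Lower bound for overlaps of three- and four-qubit tensors. -/

/-- Here `f`, `g` are the squared norms of the slices, `p`, `r` the moduli of their determinants,
and `u`, `1 - u` the squared moduli of the slice coefficients. The W state is an extremal case: `f =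
u = 2/3`, `p = 1/3`, `r = 0`. -/
theorem exists_weight_aux {f g p r : ℝ} (hg : 0 ≤ g) (hfg : f + g = 1) (hle : g ≤ f)
    (hp : 0 ≤ p) (hpf : 2 * p ≤ f) (hr : 0 ≤ r) (hrg : 2 * r ≤ g) :
    ∃ u : ℝ, 0 ≤ u ∧ u ≤ 1 ∧
      (4 / 9) ^ 2 - 4 / 9 * (f * u + g * (1 - u)) + (p * u - r * (1 - u)) ^ 2 ≤ 0 := by
  obtain rfl : g = 1 - f := by linarith
  -- The condition `g ≤ u` is equivalent to `g (1 - u) ≤ f u`, so both determinant terms are at most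
  -- `f u / 2`, and so is their difference in absolute value.
  have key : ∀ u : ℝ, 0 ≤ u → u ≤ 1 → 1 - f ≤ u →
      (p * u - r * (1 - u)) ^ 2 ≤ (f * u / 2) ^ 2 := by
    intro u h0 h1 hu
    refine sq_le_sq' ?_ ?_
    · nlinarith [mul_nonneg hp h0, mul_le_mul_of_nonneg_right hrg (sub_nonneg.2 h1)]
    · nlinarith [mul_nonneg hr (sub_nonneg.2 h1)]
  rcases le_total f (3 / 5) with h | h
  -- For `f` near 1/2 the smallest `u` allowed by `key` suffices: the bound becomes a quadratic in
  -- `f (1 - f)`, negative on `[6/25, 1/4]`.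
  · refine ⟨1 - f, by linarith, by linarith, ?_⟩
    have := key (1 - f) hg (by linarith) le_rfl
    have hg1 : 6 / 25 ≤ f * (1 - f) := by nlinarith
    have hg2 : f * (1 - f) ≤ 1 / 4 := by nlinarith [sq_nonneg (f - 1 / 2)]
    nlinarith
  · have hf0 : 0 < f := by linarith
    -- This `u` minimises the quadratic left after replacing the determinant term by `(f u / 2)²`.
    set u : ℝ := 8 * (2 * f - 1) / (9 * f ^ 2) with hu
    have hu' : 9 * f ^ 2 * u = 8 * (2 * f - 1) := by rw [hu]; field_simp
    have h0 : 0 ≤ u := by rw [hu]; apply div_nonneg <;> nlinarith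
    have h1 : u ≤ 1 := by
      rw [hu, div_le_one (by positivity)]; nlinarith [sq_nonneg (f - 8 / 9)]
    have h2 : 1 - f ≤ u := by
      rw [hu, le_div_iff₀ (by positivity)]
      nlinarith [mul_nonneg hf0.le (sq_nonneg (f - 2 / 3)), sq_nonneg (f - 2 / 3)]
    refine ⟨u, h0, h1, ?_⟩
    have := key u h0 h1 h2
    have e : f ^ 2 * ((4 / 9) ^ 2 - 4 / 9 * (f * u + (1 - f) * (1 - u)) + (f * u / 2) ^ 2)
        = - (4 / 9) * (1 - f) * (f - 2 / 3) ^ 2 := by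
      have e2 : f ^ 2 * (f * u / 2) ^ 2 = (4 / 9 * (2 * f - 1)) ^ 2 := by
        have : f * (f * u / 2) = 4 / 9 * (2 * f - 1) := by linarith
        rw [← this]; ring
      linear_combination e2 - 4 / 81 * (2 * f - 1) * hu'
    have e3 : f ^ 2 * ((4 / 9) ^ 2 - 4 / 9 * (f * u + (1 - f) * (1 - u)) + (f * u / 2) ^ 2) ≤ 0 := by
      rw [e]; nlinarith [mul_nonneg hg (sq_nonneg (f - 2 / 3))]
    have := nonpos_of_mul_nonpos_right e3 (by positivity)
    linarith

theorem exists_weight {f g p r : ℝ} (hfg : f + g = 1)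
    (hp : 0 ≤ p) (hpf : 2 * p ≤ f) (hr : 0 ≤ r) (hrg : 2 * r ≤ g) :
    ∃ u : ℝ, 0 ≤ u ∧ u ≤ 1 ∧
      (4 / 9) ^ 2 - 4 / 9 * (f * u + g * (1 - u)) + (p * u - r * (1 - u)) ^ 2 ≤ 0 := by
  rcases le_total g f with h | h
  · exact exists_weight_aux (by linarith) hfg h hp hpf hr hrg
  · obtain ⟨u, h0, h1, hu⟩ :=
      exists_weight_aux (by linarith) (by linarith) h hr hrg hp hpf
    exact ⟨1 - u, by linarith, by linarith, by nlinarith⟩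

/-- A suitable phase `w` makes `p` and `r w²` point in opposite directions. -/
theorem exists_phase (p r : ℂ) :
    ∃ w : ℂ, ‖w‖ = 1 ∧ ∀ u v : ℝ, ‖p * u + r * w ^ 2 * v‖ = |‖p‖ * u - ‖r‖ * v| := by
  have key : ∃ c w : ℂ, ‖c‖ = 1 ∧ ‖w‖ = 1 ∧ p = ‖p‖ * c ∧ r * w ^ 2 = -(‖r‖ * c) := by
    have hc : ∀ q : ℂ, ∃ c : ℂ, ‖c‖ = 1 ∧ q = ‖q‖ * c := fun q =>
      ⟨Complex.exp (q.arg * Complex.I), Complex.norm_exp_ofReal_mul_I _,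
        (Complex.norm_mul_exp_arg_mul_I q).symm⟩
    obtain ⟨c, hc1, hc2⟩ := hc p
    obtain ⟨e, he1, he2⟩ := hc r
    have he0 : e ≠ 0 := by rintro rfl; simp at he1
    -- With `c`, `e` the phases of `p`, `r`, the phase of `r w²` must be `-c`, so `w` is a square
    -- root of `-c / e`.
    obtain ⟨w, hw⟩ := IsAlgClosed.exists_eq_mul_self (-(c / e))
    have hw2 : ‖w‖ * ‖w‖ = 1 := by rw [← norm_mul, ← hw]; simp [hc1, he1]
    refine ⟨c, w, hc1, by nlinarith [norm_nonneg w], hc2, ?_⟩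
    rw [pow_two, ← hw]
    nth_rewrite 1 [he2]
    field_simp
  obtain ⟨c, w, hc, hw, hp, hr⟩ := key
  refine ⟨w, hw, fun u v => ?_⟩
  rw [hr]
  nth_rewrite 1 [hp]
  have : (‖p‖ * c * u + -(‖r‖ * c) * v : ℂ) = ((‖p‖ * u - ‖r‖ * v : ℝ) : ℂ) * c := by
    push_cast; ring
  rw [this, norm_mul, hc, Complex.norm_real, mul_one, Real.norm_eq_abs]

/-- Takagi diagonalisation of a complex symmetric `2 × 2` matrix. -/
theorem exists_takagi (p s r : ℂ) :
    ∃ a b : ℂ, ‖a‖ ^ 2 + ‖b‖ ^ 2 = 1 ∧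
      p * a * (-star b) + s * (a * star a - b * star b) + r * b * star a = 0 := by
  let q : ℂ × ℂ → ℂ := fun z => p * z.1 ^ 2 + 2 * s * z.1 * z.2 + r * z.2 ^ 2
  let K : Set (ℂ × ℂ) := {z | ‖z.1‖ ^ 2 + ‖z.2‖ ^ 2 = 1}
  have hK : IsCompact K := by
    refine Metric.isCompact_of_isClosed_isBounded
      (isClosed_eq (by fun_prop) continuous_const) ?_
    refine (Metric.isBounded_closedBall (x := (0 : ℂ × ℂ)) (r := 1)).subset fun z hz => ?_
    have hz' : ‖z.1‖ ^ 2 + ‖z.2‖ ^ 2 = 1 := hz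
    rw [mem_closedBall_zero_iff, Prod.norm_def]
    exact max_le (by nlinarith [norm_nonneg z.1, sq_nonneg ‖z.2‖])
      (by nlinarith [norm_nonneg z.2, sq_nonneg ‖z.1‖])
  -- At a maximiser of `‖q‖` on the unit sphere, the first variation along the orthogonal vector
  -- `(-star b, star a)` vanishes, and that variation is the required off-diagonal entry.
  obtain ⟨⟨a, b⟩, hab, hmax⟩ := hK.exists_isMaxOn (f := fun z => ‖q z‖)
    ⟨(1, 0), by simp [K]⟩ (by fun_prop)
  have hab' : ‖a‖ ^ 2 + ‖b‖ ^ 2 = 1 := hab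
  have hbound : ∀ x y : ℂ, ‖q (x, y)‖ ≤ ‖q (a, b)‖ * (‖x‖ ^ 2 + ‖y‖ ^ 2) := by
    intro x y
    set N := ‖x‖ ^ 2 + ‖y‖ ^ 2 with hN
    rcases (by positivity : 0 ≤ N).eq_or_lt with h0 | h0
    · have hx : x = 0 := by
        rw [← norm_eq_zero, ← sq_eq_zero_iff]; nlinarith [sq_nonneg ‖x‖, sq_nonneg ‖y‖]
      have hy : y = 0 := by
        rw [← norm_eq_zero, ← sq_eq_zero_iff]; nlinarith [sq_nonneg ‖x‖, sq_nonneg ‖y‖]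
      rw [← h0]; simp [q, hx, hy]
    · have hs : (√N) ^ 2 = N := Real.sq_sqrt h0.le
      have hs0 : 0 < √N := Real.sqrt_pos.2 h0
      have hs1 : ((√N : ℝ) : ℂ) ≠ 0 := by exact_mod_cast hs0.ne'
      have hm : (x / (√N : ℝ), y / (√N : ℝ)) ∈ K := by
        simp only [K, Set.mem_ofPred_eq, norm_div, Complex.norm_real, Real.norm_eq_abs,
          abs_of_pos hs0, div_pow, hs]
        rw [← add_div, ← hN, div_self h0.ne']
      have h1 : ‖q (x / (√N : ℝ), y / (√N : ℝ))‖ ≤ ‖q (a, b)‖ := hmax hm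
      have h2 : q (x, y) = q (x / (√N : ℝ), y / (√N : ℝ)) * ((√N : ℝ) : ℂ) ^ 2 := by
        simp only [q]; field_simp
      rw [h2, norm_mul, norm_pow, Complex.norm_real, Real.norm_eq_abs, sq_abs, hs]
      gcongr
  refine ⟨a, b, hab', ?_⟩
  set B := p * a * (-star b) + s * (a * star a - b * star b) + r * b * star a with hB
  set M := q (a, b) with hM
  set Q := q (-star b, star a) with hQ
  have hQM : ‖Q‖ ≤ ‖M‖ := by
    have := hbound (-star b) (star a)
    rwa [norm_neg, norm_star, norm_star, add_comm (‖b‖ ^ 2), hab', mul_one] at this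
  have hcurve : ∀ c : ℂ, ‖M + 2 * c * B + c ^ 2 * Q‖ ≤ ‖M‖ * (1 + ‖c‖ ^ 2) := by
    intro c
    have h := hbound (a + c * -star b) (b + c * star a)
    have e1 : q (a + c * -star b, b + c * star a) = M + 2 * c * B + c ^ 2 * Q := by
      simp only [hM, hQ, hB, q]; ring
    have e2 : ‖a + c * -star b‖ ^ 2 + ‖b + c * star a‖ ^ 2 = 1 + ‖c‖ ^ 2 := by
      have : ‖a + c * -star b‖ ^ 2 + ‖b + c * star a‖ ^ 2
          = (‖a‖ ^ 2 + ‖b‖ ^ 2) * (1 + ‖c‖ ^ 2) := by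
        simp only [← Complex.normSq_eq_norm_sq, Complex.normSq_apply]
        simp
        ring
      rw [this, hab', one_mul]
    rwa [e1, e2] at h
  by_contra hB0
  have hBpos : 0 < ‖B‖ := norm_pos_iff.2 hB0
  obtain ⟨e, he, hMe⟩ : ∃ e : ℂ, ‖e‖ = 1 ∧ M = ‖M‖ * e :=
    ⟨Complex.exp (M.arg * Complex.I), Complex.norm_exp_ofReal_mul_I _,
      (Complex.norm_mul_exp_arg_mul_I M).symm⟩
  have hlin : ∀ t : ℝ, 0 < t → ‖B‖ ≤ ‖M‖ * t := by
    intro t ht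
    -- The phase of `c` aligns `c * B` with `M`: the linear gain `2t‖B‖` would beat the quadratic
    -- terms for small `t`.
    set c : ℂ := t * (e * ‖B‖ / B) with hc
    have hcn : ‖c‖ = t := by
      simp [hc, he, abs_of_pos ht, hBpos.ne']
    have h := hcurve c
    have e1 : M + 2 * c * B = ((‖M‖ + 2 * t * ‖B‖ : ℝ) : ℂ) * e := by
      rw [hc]; nth_rewrite 1 [hMe]; push_cast; field_simp
    have h1 : ‖M + 2 * c * B‖ = ‖M‖ + 2 * t * ‖B‖ := by
      rw [e1, norm_mul, he, Complex.norm_real, Real.norm_eq_abs, mul_one,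
        abs_of_nonneg (by positivity)]
    have h2 := norm_sub_le_norm_add (M + 2 * c * B) (c ^ 2 * Q)
    rw [norm_mul, norm_pow, h1, hcn] at h2
    rw [hcn] at h
    have h3 : t ^ 2 * ‖Q‖ ≤ t ^ 2 * ‖M‖ := by gcongr
    have h4 : 2 * t * ‖B‖ ≤ 2 * t * (‖M‖ * t) := by nlinarith
    exact le_of_mul_le_mul_left h4 (by positivity)
  have h := hlin (‖B‖ / (2 * (‖M‖ + 1))) (by positivity)
  rw [mul_div_assoc', le_div_iff₀ (by positivity)] at h
  nlinarith [norm_nonneg M]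

/-- If the characteristic polynomial of `CᴴC` is nonpositive at `l`, some vector is stretched by
`C` by a factor at least `√l`. -/
theorem exists_stretched (c00 c01 c10 c11 : ℂ) {l : ℝ}
    (h : l ^ 2 - l * (‖c00‖ ^ 2 + ‖c01‖ ^ 2 + ‖c10‖ ^ 2 + ‖c11‖ ^ 2)
      + ‖c00 * c11 - c01 * c10‖ ^ 2 ≤ 0) :
    ∃ y0 y1 : ℂ, 0 < ‖y0‖ ^ 2 + ‖y1‖ ^ 2 ∧
      l * (‖y0‖ ^ 2 + ‖y1‖ ^ 2) ≤ ‖c00 * y0 + c01 * y1‖ ^ 2 + ‖c10 * y0 + c11 * y1‖ ^ 2 := by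
  rcases le_or_gt l (‖c00‖ ^ 2 + ‖c10‖ ^ 2) with h1 | h1
  · exact ⟨1, 0, by simp, by simpa using h1⟩
  · set k : ℝ := l - (‖c00‖ ^ 2 + ‖c10‖ ^ 2) with hk
    have hk0 : 0 < k := sub_pos.2 h1
    -- With `H = CᴴC`, the vector `y = (H₀₁, l - H₀₀)` annihilates the first row of `l - H`, so `y*
    -- (l - H) y = k det (l - H)`.
    refine ⟨star c00 * c01 + star c10 * c11, (k : ℂ), ?_, ?_⟩
    · have : 0 < ‖(k : ℂ)‖ ^ 2 := by
        rw [Complex.norm_real, Real.norm_eq_abs, sq_abs]; positivity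
      positivity
    · have key := mul_nonpos_of_nonneg_of_nonpos hk0.le h
      rw [← sub_nonpos]
      refine le_of_eq_of_le ?_ key
      simp only [hk, ← Complex.normSq_eq_norm_sq, Complex.normSq_apply]
      simp
      ring

theorem normalize_pair {a b : ℂ} (h : 0 < ‖a‖ ^ 2 + ‖b‖ ^ 2) :
    ‖a / (√(‖a‖ ^ 2 + ‖b‖ ^ 2) : ℝ)‖ ^ 2 + ‖b / (√(‖a‖ ^ 2 + ‖b‖ ^ 2) : ℝ)‖ ^ 2 = 1 := by
  rw [norm_div, norm_div, Complex.norm_real, Real.norm_eq_abs, div_pow, div_pow, sq_abs,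
    Real.sq_sqrt h.le, ← add_div, div_self h.ne']

/-- The bilinear form of a `2 × 2` matrix exceeds `√l` on some pair of unit vectors as soon as the
characteristic polynomial of `CᴴC` is nonpositive at `l`. -/
theorem exists_bilinear_ge (c00 c01 c10 c11 : ℂ) {l : ℝ} (hl : 0 < l)
    (h : l ^ 2 - l * (‖c00‖ ^ 2 + ‖c01‖ ^ 2 + ‖c10‖ ^ 2 + ‖c11‖ ^ 2)
      + ‖c00 * c11 - c01 * c10‖ ^ 2 ≤ 0) :
    ∃ x0 x1 y0 y1 : ℂ, ‖x0‖ ^ 2 + ‖x1‖ ^ 2 = 1 ∧ ‖y0‖ ^ 2 + ‖y1‖ ^ 2 = 1 ∧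
      l ≤ ‖x0 * (c00 * y0 + c01 * y1) + x1 * (c10 * y0 + c11 * y1)‖ ^ 2 := by
  obtain ⟨y0, y1, hy, hly⟩ := exists_stretched c00 c01 c10 c11 h
  set v0 := c00 * y0 + c01 * y1 with hv0
  set v1 := c10 * y0 + c11 * y1 with hv1
  have hv : 0 < ‖v0‖ ^ 2 + ‖v1‖ ^ 2 := lt_of_lt_of_le (by positivity) hly
  have hv' : 0 < ‖star v0‖ ^ 2 + ‖star v1‖ ^ 2 := by simpa only [norm_star] using hv
  refine ⟨_, _, _, _, normalize_pair hv', normalize_pair hy, ?_⟩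
  simp only [norm_star]
  set s := √(‖v0‖ ^ 2 + ‖v1‖ ^ 2) with hs
  set r := √(‖y0‖ ^ 2 + ‖y1‖ ^ 2) with hr
  have hs0 : 0 < s := Real.sqrt_pos.2 hv
  -- The left vector is the normalised conjugate of `Cy`, the equality case of Cauchy–Schwarz; the
  -- form then equals `s / r`.
  have hr0 : 0 < r := Real.sqrt_pos.2 hy
  have hsC : (s : ℂ) ≠ 0 := by exact_mod_cast hs0.ne'
  have hrC : (r : ℂ) ≠ 0 := by exact_mod_cast hr0.ne'
  have e1 : star v0 * v0 + star v1 * v1 = (s : ℂ) ^ 2 := by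
    rw [← Complex.ofReal_pow, hs, Real.sq_sqrt hv.le]
    push_cast
    rw [← Complex.conj_mul', ← Complex.conj_mul']; rfl
  have e2 : star v0 / (s : ℂ) * (c00 * (y0 / r) + c01 * (y1 / r))
      + star v1 / s * (c10 * (y0 / r) + c11 * (y1 / r)) = ((s / r : ℝ) : ℂ) := by
    have : star v0 / (s : ℂ) * (c00 * (y0 / r) + c01 * (y1 / r))
      + star v1 / s * (c10 * (y0 / r) + c11 * (y1 / r))
      = (star v0 * v0 + star v1 * v1) / (s * r) := by
      rw [hv0, hv1]; field_simp
    rw [this, e1]; push_cast; field_simp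
  rw [e2, Complex.norm_real, Real.norm_eq_abs, sq_abs, div_pow, hs, hr, Real.sq_sqrt hv.le,
    Real.sq_sqrt hy.le, le_div_iff₀ hy]
  exact hly

theorem two_mul_norm_det_le (a b c d : ℂ) :
    2 * ‖a * d - b * c‖ ≤ ‖a‖ ^ 2 + ‖b‖ ^ 2 + ‖c‖ ^ 2 + ‖d‖ ^ 2 := by
  have h := norm_sub_le (a * d) (b * c)
  rw [norm_mul, norm_mul] at h
  nlinarith [sq_nonneg (‖a‖ - ‖d‖), sq_nonneg (‖b‖ - ‖c‖)]

theorem norm_rotate {a b : ℂ} (h : ‖a‖ ^ 2 + ‖b‖ ^ 2 = 1) (x y : ℂ) :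
    ‖a * x + b * y‖ ^ 2 + ‖-star b * x + star a * y‖ ^ 2 = ‖x‖ ^ 2 + ‖y‖ ^ 2 := by
  have : ‖a * x + b * y‖ ^ 2 + ‖-star b * x + star a * y‖ ^ 2
      = (‖a‖ ^ 2 + ‖b‖ ^ 2) * (‖x‖ ^ 2 + ‖y‖ ^ 2) := by
    simp only [← Complex.normSq_eq_norm_sq, Complex.normSq_apply]
    simp
    ring
  rw [this, h, one_mul]

theorem norm_add_sub_sq (x y : ℂ) :
    ‖x + y‖ ^ 2 + ‖x - y‖ ^ 2 = 2 * (‖x‖ ^ 2 + ‖y‖ ^ 2) := by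
  simp only [← Complex.normSq_eq_norm_sq, Complex.normSq_apply]
  simp
  ring

/-- A unit three-qubit tensor with slices `A`, `B` whose determinants have no mixed term. -/
theorem exists_slice_of_diagonal (a00 a01 a10 a11 b00 b01 b10 b11 : ℂ)
    (hN : ‖a00‖ ^ 2 + ‖a01‖ ^ 2 + ‖a10‖ ^ 2 + ‖a11‖ ^ 2
      + (‖b00‖ ^ 2 + ‖b01‖ ^ 2 + ‖b10‖ ^ 2 + ‖b11‖ ^ 2) = 1)
    (hmix : a00 * b11 + a11 * b00 - a01 * b10 - a10 * b01 = 0) :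
    ∃ z0 z1 : ℂ, ‖z0‖ ^ 2 + ‖z1‖ ^ 2 = 1 ∧
      (4 / 9 : ℝ) ^ 2 - 4 / 9 * (‖z0 * a00 + z1 * b00‖ ^ 2 + ‖z0 * a01 + z1 * b01‖ ^ 2
        + ‖z0 * a10 + z1 * b10‖ ^ 2 + ‖z0 * a11 + z1 * b11‖ ^ 2)
        + ‖(z0 * a00 + z1 * b00) * (z0 * a11 + z1 * b11)
          - (z0 * a01 + z1 * b01) * (z0 * a10 + z1 * b10)‖ ^ 2 ≤ 0 := by
  obtain ⟨u, hu0, hu1, hu⟩ := exists_weight hN (norm_nonneg _)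
    (two_mul_norm_det_le a00 a01 a10 a11) (norm_nonneg _) (two_mul_norm_det_le b00 b01 b10 b11)
  obtain ⟨w, hw, hphase⟩ := exists_phase (a00 * a11 - a01 * a10) (b00 * b11 - b01 * b10)
  have hph := hphase u (1 - u)
  have hu1' : 0 ≤ 1 - u := by linarith
  -- The candidates are `(α, γ)` and `(α, -γ)`. Without a mixed term the determinant sees only `γ²`,
  -- so both give the same determinant, while their squared norms average to `f u + g (1 - u)`; the
  -- larger is taken.
  set α : ℂ := ((√u : ℝ) : ℂ) with hα
  set γ : ℂ := w * ((√(1 - u) : ℝ) : ℂ) with hγ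
  have hα2 : α ^ 2 = u := by rw [hα, ← Complex.ofReal_pow, Real.sq_sqrt hu0]
  have hγ2 : γ ^ 2 = w ^ 2 * (1 - u : ℝ) := by
    rw [hγ, mul_pow, ← Complex.ofReal_pow, Real.sq_sqrt hu1']
  have hαn : ‖α‖ ^ 2 = u := by
    rw [hα, Complex.norm_real, Real.norm_eq_abs, sq_abs, Real.sq_sqrt hu0]
  have hγn : ‖γ‖ ^ 2 = 1 - u := by
    rw [hγ, norm_mul, hw, one_mul, Complex.norm_real, Real.norm_eq_abs, sq_abs,
      Real.sq_sqrt hu1']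
  have hD : ∀ z1 : ℂ, z1 ^ 2 = γ ^ 2 → ‖(α * a00 + z1 * b00) * (α * a11 + z1 * b11)
          - (α * a01 + z1 * b01) * (α * a10 + z1 * b10)‖ ^ 2
      = (‖a00 * a11 - a01 * a10‖ * u - ‖b00 * b11 - b01 * b10‖ * (1 - u)) ^ 2 := by
    intro z1 hz1
    rw [← sq_abs (‖a00 * a11 - a01 * a10‖ * u - _), ← hph]
    congr 2
    rw [hγ2] at hz1
    linear_combination (a00 * a11 - a01 * a10) * hα2 + (b00 * b11 - b01 * b10) * hz1
      + α * z1 * hmix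
  have hpar : ∀ x y : ℂ, ‖α * x + γ * y‖ ^ 2 + ‖α * x + -γ * y‖ ^ 2
      = 2 * (u * ‖x‖ ^ 2 + (1 - u) * ‖y‖ ^ 2) := by
    intro x y
    have := norm_add_sub_sq (α * x) (γ * y)
    rw [norm_mul α, norm_mul γ, mul_pow, mul_pow, hαn, hγn] at this
    rw [← this, neg_mul, ← sub_eq_add_neg]
  have h00 := hpar a00 b00
  have h01 := hpar a01 b01
  have h10 := hpar a10 b10
  have h11 := hpar a11 b11
  by_cases hs : ‖α * a00 + -γ * b00‖ ^ 2 + ‖α * a01 + -γ * b01‖ ^ 2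
        + ‖α * a10 + -γ * b10‖ ^ 2 + ‖α * a11 + -γ * b11‖ ^ 2
      ≤ ‖α * a00 + γ * b00‖ ^ 2 + ‖α * a01 + γ * b01‖ ^ 2
        + ‖α * a10 + γ * b10‖ ^ 2 + ‖α * a11 + γ * b11‖ ^ 2
  · refine ⟨α, γ, by rw [hαn, hγn]; ring, ?_⟩
    rw [hD γ rfl]
    linarith
  · refine ⟨α, -γ, by rw [norm_neg, hαn, hγn]; ring, ?_⟩
    rw [hD (-γ) (neg_sq γ)]
    linarith

/-- The spectral norm of a unit three-qubit tensor is at least `2 / 3`. -/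
theorem exists_three_qubit_overlap_of_unit (t : Fin 2 → Fin 2 → Fin 2 → ℂ)
    (hN : ∑ i, ∑ j, ∑ k, ‖t i j k‖ ^ 2 = 1) :
    ∃ z x y : Fin 2 → ℂ, ‖z 0‖ ^ 2 + ‖z 1‖ ^ 2 = 1 ∧ ‖x 0‖ ^ 2 + ‖x 1‖ ^ 2 = 1 ∧
      ‖y 0‖ ^ 2 + ‖y 1‖ ^ 2 = 1 ∧ 4 / 9 ≤ ‖∑ i, ∑ j, ∑ k, z i * x j * y k * t i j k‖ ^ 2 := by
  simp only [Fin.sum_univ_two] at hN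
  -- The coefficients are those of `2 det (z₀A + z₁B)`; doubling avoids halving the mixed term.
  obtain ⟨a, b, hab, hB⟩ := exists_takagi
    (2 * (t 0 0 0 * t 0 1 1 - t 0 0 1 * t 0 1 0))
    (t 0 0 0 * t 1 1 1 + t 0 1 1 * t 1 0 0 - t 0 0 1 * t 1 1 0 - t 0 1 0 * t 1 0 1)
    (2 * (t 1 0 0 * t 1 1 1 - t 1 0 1 * t 1 1 0))
  have hr := fun j k => norm_rotate hab (t 0 j k) (t 1 j k)
  obtain ⟨z0, z1, hz, hl⟩ := exists_slice_of_diagonal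
    (a * t 0 0 0 + b * t 1 0 0) (a * t 0 0 1 + b * t 1 0 1)
    (a * t 0 1 0 + b * t 1 1 0) (a * t 0 1 1 + b * t 1 1 1)
    (-star b * t 0 0 0 + star a * t 1 0 0) (-star b * t 0 0 1 + star a * t 1 0 1)
    (-star b * t 0 1 0 + star a * t 1 1 0) (-star b * t 0 1 1 + star a * t 1 1 1)
    (by linarith [hr 0 0, hr 0 1, hr 1 0, hr 1 1])
    (by linear_combination hB)
  obtain ⟨x0, x1, y0, y1, hx, hy, hxy⟩ := exists_bilinear_ge _ _ _ _ (by norm_num) hl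
  refine ⟨![z0 * a - z1 * star b, z0 * b + z1 * star a], ![x0, x1], ![y0, y1], ?_,
    by simpa using hx, by simpa using hy, hxy.trans_eq ?_⟩
  · have h2 := norm_rotate (a := a) (b := -star b) (by simpa using hab) z0 z1
    simp only [Matrix.cons_val_zero, Matrix.cons_val_one]
    rw [← hz, ← h2]
    simp only [neg_neg, star_neg, star_star]
    congr 3 <;> ring
  · simp only [Fin.sum_univ_two, Matrix.cons_val_zero, Matrix.cons_val_one]
    congr 2
    ring

theorem exists_three_qubit_overlap (t : Fin 2 → Fin 2 → Fin 2 → ℂ) :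
    ∃ z x y : Fin 2 → ℂ, ‖z 0‖ ^ 2 + ‖z 1‖ ^ 2 = 1 ∧ ‖x 0‖ ^ 2 + ‖x 1‖ ^ 2 = 1 ∧
      ‖y 0‖ ^ 2 + ‖y 1‖ ^ 2 = 1 ∧ 4 / 9 * ∑ i, ∑ j, ∑ k, ‖t i j k‖ ^ 2 ≤
        ‖∑ i, ∑ j, ∑ k, z i * x j * y k * t i j k‖ ^ 2 := by
  set N := ∑ i, ∑ j, ∑ k, ‖t i j k‖ ^ 2 with hN
  rcases (by positivity : 0 ≤ N).eq_or_lt with h0 | h0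
  · refine ⟨![1, 0], ![1, 0], ![1, 0], by simp, by simp, by simp, ?_⟩
    rw [← h0, mul_zero]; positivity
  · have hs : (√N) ^ 2 = N := Real.sq_sqrt h0.le
    have hs0 : 0 < √N := Real.sqrt_pos.2 h0
    obtain ⟨z, x, y, hz, hx, hy, h⟩ := exists_three_qubit_overlap_of_unit
      (fun i j k => t i j k / (√N : ℝ)) (by
      simp only [norm_div, Complex.norm_real, Real.norm_eq_abs, div_pow, sq_abs, hs,
        ← Finset.sum_div]
      rw [← hN, div_self h0.ne'])
    refine ⟨z, x, y, hz, hx, hy, ?_⟩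
    simp only [← mul_div_assoc, ← Finset.sum_div] at h
    rw [norm_div, div_pow, Complex.norm_real, Real.norm_eq_abs, sq_abs, hs,
      le_div_iff₀ h0] at h
    exact h

/-- Some `4`-qubit product state has overlap at least `√2 / 3` with a given unit tensor. -/
theorem exists_four_qubit_overlap (t : Fin 2 → Fin 2 → Fin 2 → Fin 2 → ℂ)
    (hN : ∑ h, ∑ i, ∑ j, ∑ k, ‖t h i j k‖ ^ 2 = 1) :
    ∃ v z x y : Fin 2 → ℂ, ‖v 0‖ ^ 2 + ‖v 1‖ ^ 2 = 1 ∧ ‖z 0‖ ^ 2 + ‖z 1‖ ^ 2 = 1 ∧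
      ‖x 0‖ ^ 2 + ‖x 1‖ ^ 2 = 1 ∧ ‖y 0‖ ^ 2 + ‖y 1‖ ^ 2 = 1 ∧
      2 / 9 ≤ ‖∑ h, ∑ i, ∑ j, ∑ k, v h * z i * x j * y k * t h i j k‖ ^ 2 := by
  rw [Fin.sum_univ_two] at hN
  rcases le_or_gt (1 / 2) (∑ i, ∑ j, ∑ k, ‖t 0 i j k‖ ^ 2) with h | h
  · obtain ⟨z, x, y, hz, hx, hy, hle⟩ := exists_three_qubit_overlap (t 0)
    refine ⟨![1, 0], z, x, y, by simp, hz, hx, hy, ?_⟩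
    have : (2 / 9 : ℝ) ≤ 4 / 9 * ∑ i, ∑ j, ∑ k, ‖t 0 i j k‖ ^ 2 := by linarith
    simpa [Fin.sum_univ_two] using this.trans hle
  · obtain ⟨z, x, y, hz, hx, hy, hle⟩ := exists_three_qubit_overlap (t 1)
    refine ⟨![0, 1], z, x, y, by simp, hz, hx, hy, ?_⟩
    have : (2 / 9 : ℝ) ≤ 4 / 9 * ∑ i, ∑ j, ∑ k, ‖t 1 i j k‖ ^ 2 := by linarith
    simpa [Fin.sum_univ_two] using this.trans hle

/-! ### Upper bound for the form of `M4`. -/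

/-- The square of a stretching factor of a `2 × 2` matrix lies between the squared singular
values. -/
theorem stretch_sq_le (c00 c01 c10 c11 y0 y1 : ℂ) (hy : ‖y0‖ ^ 2 + ‖y1‖ ^ 2 = 1) :
    ‖c00 * c11 - c01 * c10‖ ^ 2 ≤
      (‖c00 * y0 + c01 * y1‖ ^ 2 + ‖c10 * y0 + c11 * y1‖ ^ 2) *
        (‖c00‖ ^ 2 + ‖c01‖ ^ 2 + ‖c10‖ ^ 2 + ‖c11‖ ^ 2
          - (‖c00 * y0 + c01 * y1‖ ^ 2 + ‖c10 * y0 + c11 * y1‖ ^ 2)) := by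
  have h0 := norm_rotate hy c00 c01
  have h1 := norm_rotate hy c10 c11
  set p0 := y0 * c00 + y1 * c01 with hp0
  set p1 := y0 * c10 + y1 * c11 with hp1
  set q0 := -star y1 * c00 + star y0 * c01 with hq0
  set q1 := -star y1 * c10 + star y0 * c11 with hq1
  have e0 : c00 * y0 + c01 * y1 = p0 := by rw [hp0]; ring
  have e1 : c10 * y0 + c11 * y1 = p1 := by rw [hp1]; ring
  have hu : y0 * star y0 + y1 * star y1 = 1 := by
    have := congrArg (fun r : ℝ => (r : ℂ)) hy
    push_cast at this
    rwa [← Complex.mul_conj', ← Complex.mul_conj'] at this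
  have hdet : c00 * c11 - c01 * c10 = p0 * q1 - p1 * q0 := by
    rw [hp0, hp1, hq0, hq1]; linear_combination -(c00 * c11 - c01 * c10) * hu
  have hF : ‖c00‖ ^ 2 + ‖c01‖ ^ 2 + ‖c10‖ ^ 2 + ‖c11‖ ^ 2 - (‖p0‖ ^ 2 + ‖p1‖ ^ 2)
      = ‖q0‖ ^ 2 + ‖q1‖ ^ 2 := by linarith
  rw [e0, e1, hdet, hF]
  -- In the rotated basis the columns are `p`, `q`, and the claim is Hadamard's inequality `|det|² ≤
  -- ‖p‖² ‖q‖²`.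
  have h2 := norm_sub_le (p0 * q1) (p1 * q0)
  rw [norm_mul, norm_mul] at h2
  have h3 : ‖p0 * q1 - p1 * q0‖ ^ 2 ≤ (‖p0‖ * ‖q1‖ + ‖p1‖ * ‖q0‖) ^ 2 := by gcongr
  nlinarith [sq_nonneg (‖p0‖ * ‖q0‖ - ‖p1‖ * ‖q1‖)]

theorem bilinear_sq_le (x0 x1 v0 v1 : ℂ) (hx : ‖x0‖ ^ 2 + ‖x1‖ ^ 2 = 1) :
    ‖x0 * v0 + x1 * v1‖ ^ 2 ≤ ‖v0‖ ^ 2 + ‖v1‖ ^ 2 := by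
  rw [← norm_rotate hx v0 v1]
  exact le_add_of_nonneg_right (by positivity)

/-- The four-linear form of `√6 M₄` is bounded by `2 / √3` on unit vectors. -/
theorem m4_form_le {ω : ℂ} (hω : ω ^ 2 + ω + 1 = 0) (hωn : ‖ω‖ = 1)
    {x0 x1 y0 y1 z0 z1 w0 w1 : ℂ}
    (hx : ‖x0‖ ^ 2 + ‖x1‖ ^ 2 = 1) (hy : ‖y0‖ ^ 2 + ‖y1‖ ^ 2 = 1)
    (hz : ‖z0‖ ^ 2 + ‖z1‖ ^ 2 = 1) (hw : ‖w0‖ ^ 2 + ‖w1‖ ^ 2 = 1) :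
    ‖x0 * y0 * z1 * w1 + x1 * y1 * z0 * w0 + ω * (x1 * y0 * z1 * w0 + x0 * y1 * z0 * w1)
      + ω ^ 2 * (x1 * y0 * z0 * w1 + x0 * y1 * z1 * w0)‖ ^ 2 ≤ 4 / 3 := by
  set c01 := ω * (z0 * w1) + ω ^ 2 * (z1 * w0) with hc01
  set c10 := ω * (z1 * w0) + ω ^ 2 * (z0 * w1) with hc10
  have h1 := bilinear_sq_le x0 x1 (z1 * w1 * y0 + c01 * y1) (c10 * y0 + z0 * w0 * y1) hx
  have h2 := stretch_sq_le (z1 * w1) c01 c10 (z0 * w0) y0 y1 hy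
  set m := ‖z1 * w1 * y0 + c01 * y1‖ ^ 2 + ‖c10 * y0 + z0 * w0 * y1‖ ^ 2 with hm
  set t := ‖z0 * w1 - z1 * w0‖ ^ 2 with ht
  have hω3 : ω ^ 3 = 1 := by linear_combination (ω - 1) * hω
  have hdet : z1 * w1 * (z0 * w0) - c01 * c10 = -(z0 * w1 - z1 * w0) ^ 2 := by
    rw [hc01, hc10]
    linear_combination (-(z0 * w1) ^ 2 - (z1 * w0) ^ 2 - ω * (z0 * w1 * (z1 * w0))) * hω3
      + (-z0 * w1 * z1 * w0) * hω
  have hF : ‖z1 * w1‖ ^ 2 + ‖c01‖ ^ 2 + ‖c10‖ ^ 2 + ‖z0 * w0‖ ^ 2 = 1 + t := by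
    have hr : 2 * ω.re = -1 := by
      have h3 : ω * star ω = 1 := by
        have := Complex.mul_conj' ω
        rw [hωn] at this
        simpa using this
      have h4 : ω + star ω = -1 := by linear_combination star ω * hω - (ω + 1) * h3
      have h5 := congrArg Complex.re h4
      simp at h5
      linarith
    have e1 : c01 = ω * (z0 * w1 + ω * (z1 * w0)) := by rw [hc01]; ring
    have e2 : c10 = ω * (z1 * w0 + ω * (z0 * w1)) := by rw [hc10]; ring
    have key : ∀ u v : ℂ, ‖u + ω * v‖ ^ 2 + ‖v + ω * u‖ ^ 2
        = ‖u‖ ^ 2 + ‖v‖ ^ 2 + ‖u - v‖ ^ 2 := by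
      intro u v
      have hn : ω.re * ω.re + ω.im * ω.im = 1 := by
        rw [← Complex.normSq_apply, Complex.normSq_eq_norm_sq, hωn]; norm_num
      simp only [← Complex.normSq_eq_norm_sq, Complex.normSq_apply]
      simp
      linear_combination (u.re ^ 2 + u.im ^ 2 + v.re ^ 2 + v.im ^ 2) * hn
        + 2 * (u.re * v.re + u.im * v.im) * hr
    have hkey := key (z0 * w1) (z1 * w0)
    rw [e1, e2, norm_mul ω, norm_mul ω, hωn, one_mul, one_mul]
    have hone : ‖z1 * w1‖ ^ 2 + ‖z0 * w0‖ ^ 2 + ‖z0 * w1‖ ^ 2 + ‖z1 * w0‖ ^ 2 = 1 := by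
      simp only [norm_mul, mul_pow]
      linear_combination (‖w0‖ ^ 2 + ‖w1‖ ^ 2) * hz + hw
    linarith
  rw [hdet, hF, norm_neg, norm_pow, ← ht] at h2
  have hm0 : 0 ≤ m := by positivity
  have hm1 : m ≤ 4 / 3 := by
    -- From `t² ≤ m (1 + t - m)`, completing the square in `t` eliminates it.
    have h3 : m * (3 * m - 4) ≤ 0 := by nlinarith [sq_nonneg (2 * t - m)]
    nlinarith
  refine le_trans (le_of_eq ?_) (h1.trans hm1)
  rw [hc01, hc10]
  congr 2
  ring

/-! ### Product states and the spectral norm in a general format. -/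

section General

variable {d : ℕ} {n : Fin d → ℕ}

theorem tprod_apply (x : (j : Fin d) → EuclideanSpace ℂ (Fin (n j)))
    (i : (j : Fin d) → Fin (n j)) : tprod x i = ∏ j, x j (i j) := rfl

theorem inner_tprod_tprod (x y : (j : Fin d) → EuclideanSpace ℂ (Fin (n j))) :
    inner ℂ (tprod x) (tprod y) = ∏ j, inner ℂ (x j) (y j) := by
  simp only [PiLp.inner_apply, tprod_apply]
  rw [Finset.prod_univ_sum, Fintype.piFinset_univ]
  refine Finset.sum_congr rfl fun i _ => ?_
  simp [Finset.prod_mul_distrib]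

theorem norm_tprod (x : (j : Fin d) → EuclideanSpace ℂ (Fin (n j))) :
    ‖tprod x‖ = ∏ j, ‖x j‖ := by
  have h := inner_tprod_tprod x x
  simp only [inner_self_eq_norm_sq_to_K, Finset.prod_pow] at h
  have h' : ‖tprod x‖ ^ 2 = (∏ j, ‖x j‖) ^ 2 := by exact_mod_cast h
  exact (sq_eq_sq₀ (norm_nonneg _) (Finset.prod_nonneg fun _ _ => norm_nonneg _)).1 h'

theorem tprod_smul (c : Fin d → ℂ) (x : (j : Fin d) → EuclideanSpace ℂ (Fin (n j))) :
    tprod (fun j => c j • x j) = (∏ j, c j) • tprod x := by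
  ext i
  simp [tprod_apply, Finset.prod_mul_distrib]

theorem continuous_tprod :
    Continuous (tprod : ((j : Fin d) → EuclideanSpace ℂ (Fin (n j))) → Tensor ℂ n) := by
  unfold tprod
  fun_prop

theorem isCompact_productStates : IsCompact (productStates ℂ n) := by
  have : productStates ℂ n = tprod '' Set.univ.pi fun j =>
      Metric.sphere (0 : EuclideanSpace ℂ (Fin (n j))) 1 := by
    ext X
    simp [productStates, Set.mem_pi, eq_comm]
  rw [this]
  exact (isCompact_univ_pi fun j => isCompact_sphere _ _).image continuous_tprod

theorem norm_of_mem_productStates {X : Tensor ℂ n} (hX : X ∈ productStates ℂ n) : ‖X‖ = 1 := by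
  obtain ⟨x, hx, rfl⟩ := hX
  simp [norm_tprod, hx]

theorem productStates_nonempty (hn : ∀ j, 0 < n j) : (productStates ℂ n).Nonempty :=
  ⟨_, fun j => EuclideanSpace.single ⟨0, hn j⟩ (1 : ℂ), by simp, rfl⟩

theorem isGreatest_spectralNorm (hn : ∀ j, 0 < n j) (T : Tensor ℂ n) :
    IsGreatest (overlaps T) (spectralNorm T) :=
  (isCompact_productStates.image (by fun_prop)).isGreatest_sSup
    ((productStates_nonempty hn).image _)

theorem norm_inner_tprod_le (hn : ∀ j, 0 < n j) (T : Tensor ℂ n)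
    (x : (j : Fin d) → EuclideanSpace ℂ (Fin (n j))) :
    ‖inner ℂ (tprod x) T‖ ≤ spectralNorm T * ∏ j, ‖x j‖ := by
  by_cases h : ∃ j, x j = 0
  · obtain ⟨j, hj⟩ := h
    have h0 : ∏ j, ‖x j‖ = 0 := Finset.prod_eq_zero (Finset.mem_univ j) (by simp [hj])
    have : tprod x = 0 := by rw [← norm_eq_zero, norm_tprod, h0]
    rw [this, h0]; simp
  · push Not at h
    set y : (j : Fin d) → EuclideanSpace ℂ (Fin (n j)) := fun j => ((‖x j‖ : ℂ)⁻¹) • x j with hy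
    have hyn : ∀ j, ‖y j‖ = 1 := fun j => by
      simp [hy, norm_smul, norm_ne_zero_iff.2 (h j)]
    have hxy : x = fun j => (‖x j‖ : ℂ) • y j := by
      funext j
      rw [hy, smul_smul, mul_inv_cancel₀ (by exact_mod_cast norm_ne_zero_iff.2 (h j)), one_smul]
    have hle : ‖inner ℂ (tprod y) T‖ ≤ spectralNorm T :=
      (isGreatest_spectralNorm hn T).2 ⟨_, ⟨y, hyn, rfl⟩, rfl⟩
    have hpos : 0 ≤ ∏ j, ‖x j‖ := Finset.prod_nonneg fun _ _ => norm_nonneg _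
    calc ‖inner ℂ (tprod x) T‖ = (∏ j, ‖x j‖) * ‖inner ℂ (tprod y) T‖ := by
          conv_lhs => rw [hxy]
          rw [tprod_smul, inner_smul_left, norm_mul]
          simp
      _ ≤ _ := by rw [mul_comm]; gcongr

theorem nuclearNorm_bddBelow (T : Tensor ℂ n) :
    BddBelow {s : ℝ | ∃ (r : ℕ) (x : Fin r → (j : Fin d) → EuclideanSpace ℂ (Fin (n j))),
      T = ∑ i, tprod (x i) ∧ s = ∑ i, ∏ j, ‖x i j‖} := by
  refine ⟨0, ?_⟩
  rintro s ⟨r, x, -, rfl⟩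
  positivity

end General

/-! ### Nuclear norm bounds by convex duality. -/

section Succ

variable {d : ℕ} {n : Fin (d + 1) → ℕ}

/-- The scalar is absorbed into factor 0, which is why at least one factor is needed: an empty
product admits no phase. -/
theorem smul_tprod_eq (c : ℂ) (x : (j : Fin (d + 1)) → EuclideanSpace ℂ (Fin (n j))) :
    c • tprod x = tprod fun j => (Fin.cons c 1 : Fin (d + 1) → ℂ) j • x j := by
  rw [tprod_smul, Fin.prod_univ_succ]
  simp

theorem prod_norm_cons_smul (c : ℂ) (x : (j : Fin (d + 1)) → EuclideanSpace ℂ (Fin (n j))) :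
    ∏ j, ‖(Fin.cons c 1 : Fin (d + 1) → ℂ) j • x j‖ = ‖c‖ * ∏ j, ‖x j‖ := by
  simp only [norm_smul, Finset.prod_mul_distrib]
  congr 1
  rw [Fin.prod_univ_succ]
  simp

theorem smul_mem_productStates {c : ℂ} (hc : ‖c‖ = 1) {X : Tensor ℂ n}
    (hX : X ∈ productStates ℂ n) : c • X ∈ productStates ℂ n := by
  obtain ⟨x, hx, rfl⟩ := hX
  refine ⟨_, fun j => ?_, smul_tprod_eq c x⟩
  rw [norm_smul, hx, mul_one]
  refine Fin.cases ?_ (fun j => ?_) j <;> simp [hc]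

/-- After a change of phase the overlap with a product state is real and nonnegative. -/
theorem exists_phase_productState (T : Tensor ℂ n) {X : Tensor ℂ n}
    (hX : X ∈ productStates ℂ n) :
    ∃ Y ∈ productStates ℂ n, inner ℂ T Y = (‖inner ℂ X T‖ : ℂ) := by
  obtain ⟨c, hc, h⟩ : ∃ c : ℂ, ‖c‖ = 1 ∧ inner ℂ T X = ‖inner ℂ T X‖ * c :=
    ⟨Complex.exp ((inner ℂ T X : ℂ).arg * Complex.I), Complex.norm_exp_ofReal_mul_I _,
      (Complex.norm_mul_exp_arg_mul_I _).symm⟩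
  refine ⟨star c • X, smul_mem_productStates (by simpa using hc) hX, ?_⟩
  have hcc : star c * c = 1 := by
    have := Complex.conj_mul' c
    rw [hc] at this
    simpa using this
  rw [inner_smul_right, h, norm_inner_symm X T]
  linear_combination (‖inner ℂ T X‖ : ℂ) * hcc

theorem decomposition_mem {ι : Type*} [Fintype ι] (T : Tensor ℂ n) (c : ι → ℂ)
    (X : ι → Tensor ℂ n) (hX : ∀ i, X i ∈ productStates ℂ n) (hT : T = ∑ i, c i • X i) :
    (∑ i, ‖c i‖) ∈ {s : ℝ | ∃ (r : ℕ)
      (x : Fin r → (j : Fin (d + 1)) → EuclideanSpace ℂ (Fin (n j))),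
      T = ∑ i, tprod (x i) ∧ s = ∑ i, ∏ j, ‖x i j‖} := by
  choose x hx hXx using hX
  let e := Fintype.equivFin ι
  refine ⟨Fintype.card ι, fun i j =>
    (Fin.cons (c (e.symm i)) 1 : Fin (d + 1) → ℂ) j • x (e.symm i) j, ?_, ?_⟩
  · rw [hT, ← e.symm.sum_comp]
    refine Finset.sum_congr rfl fun i _ => ?_
    rw [hXx, smul_tprod_eq]
  · rw [← e.symm.sum_comp]
    refine Finset.sum_congr rfl fun i _ => ?_
    rw [prod_norm_cons_smul]
    simp [hx]

theorem nuclearNorm_le_sum {ι : Type*} [Fintype ι] (T : Tensor ℂ n) (c : ι → ℂ)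
    (X : ι → Tensor ℂ n) (hX : ∀ i, X i ∈ productStates ℂ n) (hT : T = ∑ i, c i • X i) :
    nuclearNorm T ≤ ∑ i, ‖c i‖ :=
  csInf_le (nuclearNorm_bddBelow T) (decomposition_mem T c X hX hT)

theorem basis_mem_productStates (i : (j : Fin (d + 1)) → Fin (n j)) :
    EuclideanSpace.single i (1 : ℂ) ∈ productStates ℂ n := by
  refine ⟨fun j => EuclideanSpace.single (i j) 1, by simp, ?_⟩
  ext k
  rw [tprod_apply]
  simp only [PiLp.single_apply]
  rw [Finset.prod_ite_zero]
  simp [funext_iff]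

theorem eq_sum_basis (T : Tensor ℂ n) :
    T = ∑ i, T i • (EuclideanSpace.single i (1 : ℂ) : Tensor ℂ n) := by
  ext k
  simp [Pi.single_apply]

/-- The nuclear norm is bounded by the Hilbert–Schmidt norm divided by a lower bound for the
spectral norms of unit tensors. -/
theorem nuclearNorm_le_of_spectral {b : ℝ} (hb : 0 < b)
    (h : ∀ S : Tensor ℂ n, ∃ X ∈ productStates ℂ n, b * ‖S‖ ≤ ‖inner ℂ X S‖)
    (T : Tensor ℂ n) (hT : ‖T‖ = 1) : nuclearNorm T ≤ b⁻¹ := by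
  -- A separating functional `⟨S, ·⟩` would have real part at most `b‖S‖` at `b T`, yet reach at
  -- least `b‖S‖` at some product state.
  have hcl : (b : ℂ) • T ∈ closure (convexHull ℝ (productStates ℂ n)) := by
    by_contra hnot
    obtain ⟨f, u, hf, hu⟩ := RCLike.geometric_hahn_banach_closed_point (𝕜 := ℂ)
      (convex_convexHull ℝ (productStates ℂ n)).closure isClosed_closure hnot
    set S := (InnerProductSpace.toDual ℂ (Tensor ℂ n)).symm f with hS
    have hfS : ∀ v, f v = inner ℂ S v := fun v => by
      rw [hS, InnerProductSpace.toDual_symm_apply]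
    obtain ⟨X, hX, hXS⟩ := h S
    obtain ⟨Y, hY, hYS⟩ := exists_phase_productState S hX
    have h1 := hf Y (subset_closure (subset_convexHull ℝ _ hY))
    rw [hfS, hYS] at h1
    rw [hfS] at hu
    have h2 : RCLike.re (inner ℂ S ((b : ℂ) • T)) ≤ ‖S‖ * b := by
      refine (re_inner_le_norm (𝕜 := ℂ) _ _).trans_eq ?_
      rw [norm_smul, hT, Complex.norm_real, Real.norm_eq_abs, abs_of_pos hb, mul_one]
    simp only [RCLike.re_to_complex, Complex.ofReal_re] at h1 h2 hu
    linarith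
  have hb0 : (b : ℂ) ≠ 0 := by exact_mod_cast hb.ne'
  refine le_of_forall_pos_le_add fun ε hε => ?_
  set K : ℝ := (Fintype.card ((j : Fin (d + 1)) → Fin (n j)) : ℝ) with hK
  obtain ⟨C, hC, hdist⟩ := Metric.mem_closure_iff.1 hcl (ε * b / (K + 1)) (by positivity)
  obtain ⟨ι, _, w, X, hw0, hw1, hX, rfl⟩ := mem_convexHull_iff_exists_fintype.1 hC
  -- The closure costs an error `D`, expanded in the `K` basis states with coefficient sum at most
  -- `K‖D‖ ≤ ε b`; dividing by `b` leaves `b⁻¹ + ε`.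
  set D : Tensor ℂ n := (b : ℂ) • T - ∑ i, w i • X i with hD
  have hdec : T = ∑ i : ι ⊕ ((j : Fin (d + 1)) → Fin (n j)),
      (Sum.elim (fun i => (b : ℂ)⁻¹ * (w i : ℂ)) (fun i => (b : ℂ)⁻¹ * D i) i) •
        (Sum.elim X (fun i => EuclideanSpace.single i (1 : ℂ)) i : Tensor ℂ n) := by
    rw [Fintype.sum_sum_type]
    simp only [Sum.elim_inl, Sum.elim_inr, mul_smul]
    rw [← Finset.smul_sum, ← Finset.smul_sum, ← eq_sum_basis D, ← smul_add]
    have : ∑ i, (w i : ℂ) • X i = ∑ i, w i • X i := by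
      refine Finset.sum_congr rfl fun i _ => ?_
      ext k
      simp
    rw [this, hD, add_sub_cancel, smul_smul, inv_mul_cancel₀ hb0, one_smul]
  refine (nuclearNorm_le_sum T _ _ ?_ hdec).trans ?_
  · rintro (i | i)
    · exact hX i
    · exact basis_mem_productStates i
  · rw [Fintype.sum_sum_type]
    simp only [Sum.elim_inl, Sum.elim_inr, norm_mul, norm_inv, Complex.norm_real,
      Real.norm_eq_abs, abs_of_pos hb, ← Finset.mul_sum]
    have e1 : ∑ i, |w i| = 1 := by
      rw [← hw1]; exact Finset.sum_congr rfl fun i _ => abs_of_nonneg (hw0 i)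
    have e2 : ∑ i, ‖D i‖ ≤ K * ‖D‖ := by
      refine (Finset.sum_le_card_nsmul _ _ ‖D‖ fun i _ => PiLp.norm_apply_le D i).trans_eq ?_
      rw [nsmul_eq_mul, Finset.card_univ]
    have e3 : ‖D‖ < ε * b / (K + 1) := by rwa [dist_eq_norm] at hdist
    have hK0 : 0 ≤ K := by positivity
    have e4 : K * ‖D‖ ≤ ε * b := by
      rw [lt_div_iff₀ (by positivity)] at e3
      nlinarith [norm_nonneg D]
    rw [e1, mul_one]
    gcongr
    rw [inv_mul_le_iff₀ hb]
    linarith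

end Succ

/-! ### Four qubits: transfer to tensors, and the extremality of `M4`. -/

theorem sum_fin_four {M : Type*} [AddCommMonoid M] (F : (Fin 4 → Fin 2) → M) :
    ∑ i, F i = ∑ a, ∑ b, ∑ c, ∑ e, F ![a, b, c, e] := by
  simp only [← Fintype.sum_prod_type']
  refine (Fintype.sum_bijective (fun p : Fin 2 × Fin 2 × Fin 2 × Fin 2 =>
    (![p.1, p.2.1, p.2.2.1, p.2.2.2] : Fin 4 → Fin 2)) ?_ _ _ fun _ => rfl).symm
  decide

theorem norm_qubit_sq (x : EuclideanSpace ℂ (Fin 2)) : ‖x‖ ^ 2 = ‖x 0‖ ^ 2 + ‖x 1‖ ^ 2 := by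
  rw [EuclideanSpace.norm_sq_eq, Fin.sum_univ_two]

/-- The overlap of a tensor of unit norm with a suitable product state is at least `√2 / 3`. -/
theorem exists_overlap_ge_of_unit (T : Tensor ℂ (qubits 4)) (hT : ‖T‖ = 1) :
    ∃ X ∈ productStates ℂ (qubits 4), √2 / 3 ≤ ‖inner ℂ X T‖ := by
  let t : (Fin 4 → Fin 2) → ℂ := fun i => T i
  have hN : ∑ a, ∑ b, ∑ c, ∑ e, ‖t ![a, b, c, e]‖ ^ 2 = 1 := by
    rw [← sum_fin_four (fun i => ‖t i‖ ^ 2)]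
    exact (EuclideanSpace.norm_sq_eq T).symm.trans (by rw [hT, one_pow])
  obtain ⟨v, z, x, y, hv, hz, hx, hy, h⟩ :=
    exists_four_qubit_overlap (fun a b c e => t ![a, b, c, e]) hN
  have hunit : ∀ u : Fin 2 → ℂ, ‖u 0‖ ^ 2 + ‖u 1‖ ^ 2 = 1 →
      ‖(WithLp.toLp 2 (star u) : EuclideanSpace ℂ (Fin 2))‖ = 1 := fun u hu => by
    rw [← sq_eq_sq₀ (norm_nonneg _) zero_le_one, norm_qubit_sq, one_pow, ← hu]
    simp
  -- The conjugates undo the conjugate-linearity of the inner product in its first argument.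
  let X : Fin 4 → EuclideanSpace ℂ (Fin 2) := ![WithLp.toLp 2 (star v), WithLp.toLp 2 (star z),
    WithLp.toLp 2 (star x), WithLp.toLp 2 (star y)]
  refine ⟨tprod (n := qubits 4) X, ⟨X, fun j => ?_, rfl⟩, ?_⟩
  · fin_cases j
    exacts [hunit v hv, hunit z hz, hunit x hx, hunit y hy]
  · have e : inner ℂ (tprod (n := qubits 4) X) T
        = ∑ a, ∑ b, ∑ c, ∑ e, v a * z b * x c * y e * t ![a, b, c, e] := by
      rw [PiLp.inner_apply]
      refine (sum_fin_four _).trans ?_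
      simp [tprod_apply, Fin.prod_univ_four, X, t, mul_comm]
    rw [e]
    refine le_of_sq_le_sq ?_ (norm_nonneg _)
    rw [div_pow, Real.sq_sqrt (by norm_num)]
    linarith

theorem exists_overlap_ge (T : Tensor ℂ (qubits 4)) :
    ∃ X ∈ productStates ℂ (qubits 4), √2 / 3 * ‖T‖ ≤ ‖inner ℂ X T‖ := by
  by_cases h : T = 0
  · obtain ⟨X, hX⟩ := productStates_nonempty (n := qubits 4) (fun _ => two_pos)
    exact ⟨X, hX, by simp [h]⟩
  · have hn : 0 < ‖T‖ := norm_pos_iff.2 h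
    obtain ⟨X, hX, hle⟩ := exists_overlap_ge_of_unit ((‖T‖ : ℂ)⁻¹ • T)
      (by simp [norm_smul, hn.ne'])
    refine ⟨X, hX, ?_⟩
    rw [inner_smul_right, norm_mul, norm_inv, Complex.norm_real, norm_norm,
      inv_mul_eq_div, le_div_iff₀ hn] at hle
    exact hle

theorem spectralNorm_ge (T : Tensor ℂ (qubits 4)) (hT : ‖T‖ = 1) : √2 / 3 ≤ spectralNorm T := by
  obtain ⟨X, hX, h⟩ := exists_overlap_ge_of_unit T hT
  exact h.trans ((isGreatest_spectralNorm (fun _ => two_pos) T).2 ⟨X, hX, rfl⟩)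

theorem inner_tprod_ket (x : Fin 4 → EuclideanSpace ℂ (Fin 2)) (i : Fin 4 → Fin 2) :
    inner ℂ (tprod (n := qubits 4) x) (ket i) = ∏ j, star (x j (i j)) := by
  rw [ket, inner_tprod_tprod]
  refine Finset.prod_congr rfl fun j _ => ?_
  rw [EuclideanSpace.inner_single_right]
  simp

theorem omega_sq_add {ω : ℂ} (hω : ω = Complex.exp (2 * Real.pi * Complex.I / 3)) :
    ω ^ 2 + ω + 1 = 0 := by
  have h := (Complex.isPrimitiveRoot_exp 3 (by norm_num)).geom_sum_eq_zero (by norm_num)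
  simp only [Finset.sum_range_succ, Finset.sum_range_zero, Nat.cast_ofNat, ← hω] at h
  linear_combination h

theorem norm_omega {ω : ℂ} (hω : ω = Complex.exp (2 * Real.pi * Complex.I / 3)) : ‖ω‖ = 1 := by
  have : (2 * Real.pi * Complex.I / 3 : ℂ) = ((2 * Real.pi / 3 : ℝ) : ℂ) * Complex.I := by
    push_cast; ring
  rw [hω, this, Complex.norm_exp_ofReal_mul_I]

theorem norm_M4 : ‖M4‖ = 1 := by
  set ω := Complex.exp (2 * Real.pi * Complex.I / 3) with hω
  have hn := norm_omega hω
  rw [← sq_eq_sq₀ (norm_nonneg _) zero_le_one, one_pow]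
  refine (EuclideanSpace.norm_sq_eq M4).trans ((sum_fin_four _).trans ?_)
  simp only [M4, ← hω]
  simp [ket, tprod_apply, Fin.prod_univ_four, Fin.sum_univ_two, mul_pow, hn]
  norm_num

theorem overlap_M4_le {X : Tensor ℂ (qubits 4)} (hX : X ∈ productStates ℂ (qubits 4)) :
    ‖inner ℂ X M4‖ ≤ √2 / 3 := by
  obtain ⟨x, hx, rfl⟩ := hX
  set ω := Complex.exp (2 * Real.pi * Complex.I / 3) with hω
  have hu : ∀ j, ‖star (x j 0)‖ ^ 2 + ‖star (x j 1)‖ ^ 2 = 1 := fun j => by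
    rw [norm_star, norm_star, ← norm_qubit_sq, hx, one_pow]
  have key := m4_form_le (omega_sq_add hω) (norm_omega hω) (hu 0) (hu 1) (hu 2) (hu 3)
  have e : inner ℂ (tprod x) M4 = ((1 / √6 : ℝ) : ℂ) *
      (star (x 0 0) * star (x 1 0) * star (x 2 1) * star (x 3 1)
        + star (x 0 1) * star (x 1 1) * star (x 2 0) * star (x 3 0)
        + ω * (star (x 0 1) * star (x 1 0) * star (x 2 1) * star (x 3 0)
          + star (x 0 0) * star (x 1 1) * star (x 2 0) * star (x 3 1))
        + ω ^ 2 * (star (x 0 1) * star (x 1 0) * star (x 2 0) * star (x 3 1)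
          + star (x 0 0) * star (x 1 1) * star (x 2 1) * star (x 3 0))) := by
    simp only [M4, ← hω, inner_smul_right, inner_add_right, inner_tprod_ket, Fin.prod_univ_four]
    rfl
  rw [e]
  refine le_of_sq_le_sq ?_ (by positivity)
  rw [norm_mul, mul_pow, Complex.norm_real, Real.norm_eq_abs, sq_abs, div_pow, div_pow,
    Real.sq_sqrt (by norm_num), Real.sq_sqrt (by norm_num)]
  linarith

theorem spectralNorm_M4 : spectralNorm M4 = √2 / 3 := by
  refine le_antisymm ?_ (spectralNorm_ge M4 norm_M4)
  obtain ⟨X, hX, h⟩ := (isGreatest_spectralNorm (fun _ => two_pos) M4).1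
  rw [← h]
  exact overlap_M4_le hX

theorem nuclearNorm_le (T : Tensor ℂ (qubits 4)) (hT : ‖T‖ = 1) : nuclearNorm T ≤ 3 / √2 := by
  rw [← inv_div]
  exact nuclearNorm_le_of_spectral (by positivity) exists_overlap_ge T hT

/-- The nuclear and spectral norms are in duality. -/
theorem norm_sq_div_spectralNorm_le_nuclearNorm {d : ℕ} {n : Fin (d + 1) → ℕ}
    (hn : ∀ j, 0 < n j) {T : Tensor ℂ n} (hs : 0 < spectralNorm T) :
    ‖T‖ ^ 2 / spectralNorm T ≤ nuclearNorm T := by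
  refine le_csInf ⟨_, decomposition_mem T _ _ basis_mem_productStates (eq_sum_basis T)⟩ ?_
  rintro s ⟨r, x, hx, rfl⟩
  rw [div_le_iff₀ hs, mul_comm, Finset.mul_sum]
  have h1 : ‖T‖ ^ 2 = ‖inner ℂ (∑ i, tprod (x i)) T‖ := by
    rw [← hx, inner_self_eq_norm_sq_to_K]
    simp
  rw [h1, sum_inner]
  exact (norm_sum_le _ _).trans (Finset.sum_le_sum fun i _ => norm_inner_tprod_le hn T (x i))

theorem nuclearNorm_M4 : nuclearNorm M4 = 3 / √2 := by
  refine le_antisymm (nuclearNorm_le M4 norm_M4) ?_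
  have := norm_sq_div_spectralNorm_le_nuclearNorm (n := qubits 4) (fun _ => two_pos) (T := M4)
    (by rw [spectralNorm_M4]; positivity)
  rwa [norm_M4, spectralNorm_M4, one_pow, one_div_div] at this

theorem geometricMeasure_le_M4 (S : Tensor ℂ (qubits 4)) (hS : ‖S‖ = 1) :
    geometricMeasure S ≤ geometricMeasure M4 := by
  obtain ⟨X, hX, hle⟩ := exists_overlap_ge_of_unit S hS
  obtain ⟨Y, hY, hYS⟩ := exists_phase_productState S hX
  -- All vectors are unit, so comparing distances amounts to comparing real parts of overlaps: at
  -- least `√2 / 3` at `Y` for `S`, at most `√2 / 3` at every `Z` for `M4`.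
  refine (Metric.infDist_le_dist_of_mem hY).trans
    ((Metric.le_infDist (productStates_nonempty fun _ => two_pos)).2 fun Z hZ => ?_)
  rw [dist_eq_norm, dist_eq_norm]
  refine le_of_sq_le_sq ?_ (norm_nonneg _)
  rw [norm_sub_sq (𝕜 := ℂ), norm_sub_sq (𝕜 := ℂ), hS, norm_M4, norm_of_mem_productStates hY,
    norm_of_mem_productStates hZ, hYS]
  have h1 : RCLike.re (inner ℂ M4 Z) ≤ √2 / 3 := by
    refine (RCLike.re_le_norm _).trans ?_
    rw [norm_inner_symm]
    exact overlap_M4_le hZ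
  simp only [RCLike.re_to_complex, Complex.ofReal_re] at h1 ⊢
  linarith

theorem eta_le_M4 (S : Tensor ℂ (qubits 4)) (hS : ‖S‖ = 1) : eta S ≤ eta M4 := by
  have h := spectralNorm_ge S hS
  have h0 : (0 : ℝ) < √2 / 3 := by positivity
  unfold eta
  rw [spectralNorm_M4, neg_le_neg_iff]
  exact Real.logb_le_logb_of_le one_lt_two (by positivity) (by gcongr)

theorem omega_le_M4 (S : Tensor ℂ (qubits 4)) (hS : ‖S‖ = 1) : omega S ≤ omega M4 := by
  have hs : 0 < spectralNorm S := lt_of_lt_of_le (by positivity) (spectralNorm_ge S hS)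
  have h0 : 0 < nuclearNorm S := lt_of_lt_of_le (by rw [hS]; positivity)
    (norm_sq_div_spectralNorm_le_nuclearNorm (n := qubits 4) (fun _ => two_pos) hs)
  have h := nuclearNorm_le S hS
  unfold omega
  rw [nuclearNorm_M4]
  exact Real.logb_le_logb_of_le one_lt_two (by positivity) (by gcongr)

end Tensors

theorem mainTheorem2 :
    -- the spectral norm of `M₄`, a maximum that is attained
    (IsGreatest (Tensors.overlaps Tensors.M4) (√2 / 3) ∧
      Tensors.spectralNorm Tensors.M4 = √2 / 3) ∧
    -- `β(2^{×4}, ℂ)`, an attained minimum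
    (IsLeast (Tensors.spectralValues ℂ (Tensors.qubits 4)) (√2 / 3) ∧
      Tensors.beta ℂ (Tensors.qubits 4) = √2 / 3) ∧
    -- `α(2^{×4}, ℂ)`, an attained maximum
    (IsGreatest (Tensors.nuclearValues ℂ (Tensors.qubits 4)) (3 / √2) ∧
      Tensors.alpha ℂ (Tensors.qubits 4) = 3 / √2) ∧
    -- `M₄` is a most entangled 4-qubit state in every sense considered
    Tensors.IsMostEntangled Tensors.geometricMeasure Tensors.M4 ∧
    Tensors.IsMostEntangled Tensors.eta Tensors.M4 ∧
    Tensors.IsMostEntangled Tensors.omega Tensors.M4 := by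
  have hβ : IsLeast (Tensors.spectralValues ℂ (Tensors.qubits 4)) (√2 / 3) := by
    refine ⟨⟨_, Tensors.norm_M4, Tensors.spectralNorm_M4⟩, ?_⟩
    rintro _ ⟨T, hT, rfl⟩
    exact Tensors.spectralNorm_ge T hT
  have hα : IsGreatest (Tensors.nuclearValues ℂ (Tensors.qubits 4)) (3 / √2) := by
    refine ⟨⟨_, Tensors.norm_M4, Tensors.nuclearNorm_M4⟩, ?_⟩
    rintro _ ⟨T, hT, rfl⟩
    exact Tensors.nuclearNorm_le T hT
  refine ⟨⟨?_, Tensors.spectralNorm_M4⟩, ⟨hβ, hβ.csInf_eq⟩, ⟨hα, hα.csSup_eq⟩,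
    ⟨Tensors.norm_M4, Tensors.geometricMeasure_le_M4⟩, ⟨Tensors.norm_M4, Tensors.eta_le_M4⟩,
    ⟨Tensors.norm_M4, Tensors.omega_le_M4⟩⟩
  rw [← Tensors.spectralNorm_M4]
  exact Tensors.isGreatest_spectralNorm (fun _ => two_pos) Tensors.M4
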